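/- Let $\mathbb F_q$ be a finite field with $q\ge 3$ elements and characteristic $p$, let $A=\mathbb F_q[T]$ and $k=\mathbb F_q(T)$, and let $\Omega$ be an algebraically closed field containing $k$ (for instance $\mathbb C_\infty$, the completion of an algebraic closure of $\mathbb F_q((1/T))$). For an $A$-algebra $R$ let $C(R)$ be the additive group of $R$ with the Carlitz $A$-module structure, in which $\mathbb F_q$ acts by multiplication and $T$ acts by $r\mapsto Tr+r^q$; write $\phi_a(r)$ for the action of $a\in A$ on $r$. Let $U(A)\subseteq C(A)$ be the unit module, that is, the $A$-submodule generated by $1$. Let $P\in A$ be a monic irreducible polynomial, and put $\Lambda_P=\{\alpha\in\Omega:\phi_P(\alpha)=0\}$, $K_P=k(\Lambda_P)$, $\Delta=\mathrm{Gal}(K_P/k)$, $\mathfrak U=\{z\in\Omega:\phi_P(z)\in U(A)\}$, $L=K_P(\mathfrak U)$ and $G=\mathrm{Gal}(L/K_P)$. The group $G$ is abelian and killed by $p$, and $\Delta$ acts on it by $\delta\cdot g=\tilde\delta g\tilde\delta^{-1}$, where $\tilde\delta\in\mathrm{Gal}(L/k)$ is any extension of $\delta$; so $G$ is an $\mathbb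 F_p[\Delta]$-module. Let $\Delta$ act on $\mathrm{Hom}_A(U(A)/P\cdot U(A),\Lambda_P)$ through its action on $\Lambda_P$. Then there is a natural isomorphism of $\mathbb F_p[\Delta]$-modules $$G\;\simeq\;\mathrm{Hom}_A\big(U(A)/P\cdot U(A),\,\Lambda_P\big),$$ which sends $g\in G$ to the homomorphism that maps the class of $\phi_P(z)$ to $z-g(z)$, for every $z\in\mathfrak U$. -/

import Mathlib

open Polynomial

set_option linter.unusedSectionVars false

noncomputable section

namespace Carlitz

section Functor

variable (F : Type*) [Field F] [Fintype F]

/-- The `F`-linear endomorphism `r ↦ T r + r ^ q` of an `F[T]`-algebra `R`, where `q = #F`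
(the variable `T` of `F[T]` is `X` in Lean). -/
def phiT (R : Type*) [CommRing R] [Algebra F R] [Algebra F[X] R] [IsScalarTower F F[X] R] :
    R →ₗ[F] R :=
  Algebra.lsmul F F R (X : F[X]) + (FiniteField.frobeniusAlgHom F R).toLinearMap

/-- `C(R)`: a copy of the additive group of `R`, with the `F[T]`-module structure for which `F` acts
by multiplication and `T` acts as `r ↦ T r + r ^ q`. -/
def C (R : Type*) [CommRing R] [Algebra F R] [Algebra F[X] R] [IsScalarTower F F[X] R] :
    Type _ := R

section Basic

variable (R : Type*) [CommRing R] [Algebra F R] [Algebra F[X] R] [IsScalarTower F F[X] R]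

instance : AddCommGroup (C F R) := inferInstanceAs (AddCommGroup R)

/-- The identity map `R → C(R)`. -/
def of : R ≃+ C F R := AddEquiv.refl R

instance : Module F[X] (C F R) where
  smul a x := of F R (aeval (phiT F R) a ((of F R).symm x))
  one_smul x := by
    change of F R (aeval (phiT F R) 1 _) = x
    rw [map_one]
    rfl
  mul_smul a b x := by
    change of F R (aeval (phiT F R) (a * b) _) =
      of F R (aeval (phiT F R) a (aeval (phiT F R) b _))
    rw [map_mul, Module.End.mul_apply]
  smul_zero a := by
    change of F R (aeval (phiT F R) a ((of F R).symm 0)) = 0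
    simp
  smul_add a x y := by
    change of F R (aeval (phiT F R) a _) = of F R _ + of F R _
    rw [map_add, map_add, map_add]
  add_smul a b x := by
    change of F R (aeval (phiT F R) (a + b) _) = of F R _ + of F R _
    rw [map_add, LinearMap.add_apply, map_add]
  zero_smul x := by
    change of F R (aeval (phiT F R) 0 _) = 0
    simp

end Basic

variable {F}
variable {R S : Type*} [CommRing R] [Algebra F R] [Algebra F[X] R] [IsScalarTower F F[X] R]
  [CommRing S] [Algebra F S] [Algebra F[X] S] [IsScalarTower F F[X] S]

theorem phiT_apply (r : R) : phiT F R r = (X : F[X]) • r + r ^ Fintype.card F := rfl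

theorem smul_of_eq (a : F[X]) (r : R) : a • of F R r = of F R (aeval (phiT F R) a r) := rfl

theorem C_smul_of (c : F) (r : R) : Polynomial.C c • of F R r = of F R (c • r) := by
  rw [smul_of_eq, aeval_C, Module.algebraMap_end_apply]

theorem X_smul_of (r : R) :
    (X : F[X]) • of F R r = of F R ((X : F[X]) • r + r ^ Fintype.card F) := by
  rw [smul_of_eq, aeval_X, phiT_apply]

/-- A morphism of `F[T]`-algebras `R → S` is a morphism of `F[T]`-modules `C(R) → C(S)`. -/
def map (f : R →ₐ[F[X]] S) : C F R →ₗ[F[X]] C F S where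
  toFun x := of F S (f ((of F R).symm x))
  map_add' x y := by simp
  map_smul' a x := by
    obtain ⟨r, rfl⟩ := (of F R).surjective x
    rw [RingHom.id_apply, smul_of_eq, AddEquiv.symm_apply_apply, AddEquiv.symm_apply_apply,
      smul_of_eq]
    congr 1
    have hT : ∀ r, f (phiT F R r) = phiT F S (f r) := fun r => by simp [phiT_apply]
    have hc : ∀ (c : F) (r : R), f (c • r) = c • f r := map_smul (f.restrictScalars F)
    induction a using Polynomial.induction_on generalizing r with
    | C c => simp [Module.algebraMap_end_apply, hc]
    | add a b ha hb => simp [ha, hb]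
    | monomial n c h =>
      rw [pow_succ, ← mul_assoc, map_mul _ (_ * _) X, map_mul _ (_ * _) X, aeval_X, aeval_X,
        Module.End.mul_apply, Module.End.mul_apply, ← hT, h]

@[simp] theorem map_of (f : R →ₐ[F[X]] S) (r : R) : map f (of F R r) = of F S (f r) := rfl

theorem smul_of_map (f : R →ₐ[F[X]] S) (a : F[X]) (r : R) :
    (of F S).symm (a • of F S (f r)) = f ((of F R).symm (a • of F R r)) := by
  rw [← map_of, ← map_smul]
  rfl

/-- The polynomial `φ_a`, such that `a` acts on every `C(R)` as `r ↦ φ_a(r)`. -/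
def phi (a : F[X]) : F[X][X] := (of F F[X][X]).symm (a • of F F[X][X] X)

theorem aeval_phi (a : F[X]) (r : R) : aeval r (phi a) = (of F R).symm (a • of F R r) := by
  have := smul_of_map (F := F) (aeval (R := F[X]) r) a X
  rw [aeval_X] at this
  exact this.symm

theorem derivative_phi (a : F[X]) : derivative (phi a) = Polynomial.C a := by
  have hadd : ∀ a b : F[X], phi (a + b) = phi a + phi b := fun a b => by simp [phi, add_smul]
  have hmul : ∀ a : F[X], phi (X * a) = (X : F[X]) • phi a + phi a ^ Fintype.card F := fun a => by
    rw [phi, mul_smul, ← (of F F[X][X]).apply_symm_apply (a • of F F[X][X] X), X_smul_of]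
    rfl
  have hq : ((Fintype.card F : ℕ) : F[X]) = 0 := by
    rw [← Polynomial.C_eq_natCast, FiniteField.cast_card_eq_zero, Polynomial.C_0]
  induction a using Polynomial.induction_on with
  | C c =>
    have : phi (Polynomial.C c) = Polynomial.C (Polynomial.C c) * X := by
      simp [phi, C_smul_of, Algebra.smul_def]
    rw [this, derivative_C_mul, derivative_X, mul_one]
  | add a b ha hb => rw [hadd, derivative_add, ha, hb, Polynomial.C_add]
  | monomial n c h =>
    rw [pow_succ', mul_left_comm, hmul, derivative_add, derivative_smul, h, derivative_pow, hq]
    simp [Polynomial.smul_eq_C_mul]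

end Functor

section Fields

variable (F : Type*) [Field F] [Fintype F] (P : F[X])
  (Ω : Type*) [Field Ω] [Algebra F Ω] [Algebra F[X] Ω] [Algebra (RatFunc F) Ω]
  [IsScalarTower F F[X] Ω] [IsScalarTower F[X] (RatFunc F) Ω]

/- `k = F(T)` is `RatFunc F`, and `Ω` is an extension field of `k`, assumed algebraically closed
where that matters; for instance `Ω = ℂ_∞`, the completion of an algebraic closure of `F((1/T))`. -/

/-- `Λ_P = {α ∈ Ω | φ_P(α) = 0}`, as a submodule of `C(Ω)`. -/
abbrev torsion : Submodule F[X] (C F Ω) := Submodule.torsionBy F[X] (C F Ω) P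

/-- `U(A) ⊆ C(A)`, `A = F[T]`: the `A`-submodule generated by `1`. -/
abbrev unitModule : Submodule F[X] (C F F[X]) := Submodule.span F[X] {of F F[X] 1}

/-- The inclusion `C(A) → C(Ω)`. -/
abbrev incl : C F F[X] →ₗ[F[X]] C F Ω := map (Algebra.ofId F[X] Ω)

/-- `𝔘 = {z ∈ Ω | φ_P(z) ∈ U(A)}`, as a submodule of `C(Ω)`. -/
def divisionModule : Submodule F[X] (C F Ω) :=
  ((unitModule F).map (incl F Ω)).comap (LinearMap.lsmul F[X] (C F Ω) P)

/-- `K_P = k(Λ_P)`. -/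
def cyclotomicField : IntermediateField (RatFunc F) Ω :=
  IntermediateField.adjoin (RatFunc F) {x | of F Ω x ∈ torsion F P Ω}

/-- `L = K_P(𝔘)`. -/
def kummerField : IntermediateField (cyclotomicField F P Ω) Ω :=
  IntermediateField.adjoin (cyclotomicField F P Ω) {x | of F Ω x ∈ divisionModule F P Ω}

/-- `G = Gal(L/K_P)`. -/
abbrev G : Type _ := Gal(kummerField F P Ω/cyclotomicField F P Ω)

/-- `Δ = Gal(K_P/k)`. -/
abbrev Delta : Type _ := Gal(cyclotomicField F P Ω/RatFunc F)


variable {F P Ω}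

instance : IsScalarTower (RatFunc F) (kummerField F P Ω) Ω :=
  IsScalarTower.of_algebraMap_eq fun _ => rfl

variable (F) in
/-- `φ_a` with coefficients in `k`. -/
abbrev phik (a : F[X]) : (RatFunc F)[X] := (phi a).map (algebraMap F[X] (RatFunc F))

theorem smul_of (a : F[X]) (x : Ω) : a • of F Ω x = of F Ω (aeval x (phik F a)) := by
  rw [aeval_map_algebraMap, aeval_phi, AddEquiv.apply_symm_apply]

theorem mem_torsion {x : Ω} : of F Ω x ∈ torsion F P Ω ↔ aeval x (phik F P) = 0 := by
  rw [Submodule.mem_torsionBy_iff, smul_of, AddEquiv.map_eq_zero_iff]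

theorem mem_divisionModule {x : Ω} : of F Ω x ∈ divisionModule F P Ω ↔
    ∃ u ∈ unitModule F, aeval x (phik F P) =
      algebraMap (RatFunc F) Ω (algebraMap F[X] (RatFunc F) ((of F F[X]).symm u)) := by
  rw [divisionModule, Submodule.mem_comap, LinearMap.lsmul_apply, smul_of, Submodule.mem_map]
  refine exists_congr fun u => and_congr_right fun _ => ?_
  rw [← IsScalarTower.algebraMap_apply]
  exact ⟨fun h => ((of F Ω).injective h).symm, fun h => congrArg (of F Ω) h.symm⟩

theorem separable_phik_sub (hP : P ≠ 0) (c : RatFunc F) :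
    (phik F P - Polynomial.C c).Separable := by
  rw [Polynomial.separable_def, derivative_sub, derivative_C, sub_zero, derivative_map,
    derivative_phi, Polynomial.map_C]
  apply IsCoprime.symm
  obtain ⟨b, hb⟩ := ((Polynomial.isUnit_C (R := RatFunc F)).mpr
    (IsUnit.mk0 (algebraMap F[X] (RatFunc F) P) (by simpa using hP))).exists_left_inv
  exact ⟨b, 0, by rw [hb, zero_mul, add_zero]⟩

theorem normal_of_sets [IsAlgClosed Ω] (hP : P ≠ 0) (I : Set (RatFunc F)) :
    Normal (RatFunc F) (IntermediateField.adjoin (RatFunc F)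
      {x : Ω | ∃ c ∈ I, aeval x (phik F P) = algebraMap (RatFunc F) Ω c}) := by
  have : {x : Ω | ∃ c ∈ I, aeval x (phik F P) = algebraMap (RatFunc F) Ω c} =
      ⋃ c : I, (phik F P - Polynomial.C (c : RatFunc F)).rootSet Ω := by
    ext x
    simp [mem_rootSet, (separable_phik_sub hP _).ne_zero, sub_eq_zero]
  rw [this, IntermediateField.adjoin_iUnion]
  exact IntermediateField.normal_iSup (h := fun c => Normal.of_isSplittingField
    (hFEp := IntermediateField.adjoin_rootSet_isSplittingField (IsAlgClosed.splits _)))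


theorem normal_kummerField [IsAlgClosed Ω] (hP : P ≠ 0) :
    Normal (RatFunc F) (kummerField F P Ω) := by
  have h : (kummerField F P Ω).restrictScalars (RatFunc F) =
      IntermediateField.adjoin (RatFunc F) {x : Ω | ∃ c ∈ {c | ∃ u ∈ unitModule F,
        c = algebraMap F[X] (RatFunc F) ((of F F[X]).symm u)},
        aeval x (phik F P) = algebraMap (RatFunc F) Ω c} := by
    rw [kummerField, cyclotomicField, IntermediateField.adjoin_adjoin_left]
    congr 1
    ext x
    simp only [Set.mem_union, Set.mem_ofPred_eq, mem_torsion, mem_divisionModule]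
    constructor
    · rintro (h | ⟨u, hu, h⟩)
      · exact ⟨0, ⟨0, zero_mem _, by simp⟩, by simpa using h⟩
      · exact ⟨_, ⟨u, hu, rfl⟩, h⟩
    · rintro ⟨_, ⟨u, hu, rfl⟩, h⟩
      exact Or.inr ⟨u, hu, h⟩
  have hN := normal_of_sets (Ω := Ω) hP {c | ∃ u ∈ unitModule F,
        c = algebraMap F[X] (RatFunc F) ((of F F[X]).symm u)}
  rw [← h] at hN
  exact hN

theorem aeval_coe (f : (RatFunc F)[X]) (x : kummerField F P Ω) :
    aeval (x : Ω) f = ((aeval x f : kummerField F P Ω) : Ω) :=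
  aeval_algebraMap_apply Ω x f

theorem aeval_coe' (f : (RatFunc F)[X]) (x : cyclotomicField F P Ω) :
    aeval (x : Ω) f = ((aeval x f : cyclotomicField F P Ω) : Ω) :=
  aeval_algebraMap_apply Ω x f

theorem aeval_map_coe (σ : Gal(kummerField F P Ω/RatFunc F)) {x : kummerField F P Ω} {c : RatFunc F}
    (h : aeval (x : Ω) (phik F P) = algebraMap (RatFunc F) Ω c) :
    aeval ((σ x : kummerField F P Ω) : Ω) (phik F P) = algebraMap (RatFunc F) Ω c := by
  have h' : aeval x (phik F P) = algebraMap (RatFunc F) (kummerField F P Ω) c :=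
    Subtype.ext (by rw [← aeval_coe, h]; rfl)
  rw [aeval_coe, aeval_algHom_apply σ, h', AlgEquiv.commutes]
  rfl

/-- `z - g(z) ∈ Λ_P` for `z ∈ 𝔘` and `g ∈ G`. -/
theorem sub_mem_torsion (g : G F P Ω) {x : kummerField F P Ω}
    (hx : of F Ω x ∈ divisionModule F P Ω) :
    of F Ω ((x - g x : kummerField F P Ω) : Ω) ∈ torsion F P Ω := by
  obtain ⟨u, -, h⟩ := mem_divisionModule.mp hx
  have h2 := aeval_map_coe (g.restrictScalars (RatFunc F)) h
  have : of F Ω ((x - g x : kummerField F P Ω) : Ω) =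
    of F Ω (x : Ω) - of F Ω ((g x : kummerField F P Ω) : Ω) := map_sub (of F Ω) _ _
  rw [this, Submodule.mem_torsionBy_iff, smul_sub, smul_of, smul_of, h]
  erw [h2]
  exact sub_self _

/-- For `z ∈ 𝔘` and `g ∈ G`, `g` translates `z` by an element of `K_P`. -/
theorem exists_translate (g : G F P Ω) {x : kummerField F P Ω}
    (hx : of F Ω x ∈ divisionModule F P Ω) : ∃ c : cyclotomicField F P Ω,
      of F Ω (c : Ω) ∈ torsion F P Ω ∧ g x = x - algebraMap _ (kummerField F P Ω) c := by
  have h := sub_mem_torsion g hx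
  let c : cyclotomicField F P Ω :=
    ⟨((x - g x : kummerField F P Ω) : Ω), IntermediateField.subset_adjoin _ _ h⟩
  have : algebraMap (cyclotomicField F P Ω) (kummerField F P Ω) c = x - g x := Subtype.ext rfl
  exact ⟨c, h, by rw [this, sub_sub_cancel]⟩

theorem G_ext {g h : G F P Ω} (H : ∀ x : kummerField F P Ω,
    of F Ω x ∈ divisionModule F P Ω → g x = h x) : g = h := by
  have : (g : kummerField F P Ω →ₐ[cyclotomicField F P Ω] kummerField F P Ω) = h :=
    IntermediateField.algHom_ext_of_eq_adjoin _ (S := kummerField F P Ω) rfl fun x hx => H ⟨x, _⟩ hx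
  exact AlgEquiv.ext fun x => DFunLike.congr_fun this x

/-- `G` is commutative. -/
instance : CommGroup (G F P Ω) where
  mul_comm g h := G_ext fun x hx => by
    obtain ⟨c, -, hc⟩ := exists_translate g hx
    obtain ⟨d, -, hd⟩ := exists_translate h hx
    rw [AlgEquiv.mul_apply, AlgEquiv.mul_apply, hc, hd, map_sub, map_sub, hc, hd,
      AlgEquiv.commutes, AlgEquiv.commutes, sub_right_comm]

variable (p : ℕ) [Fact p.Prime] [CharP F p]

/-- `G` is killed by `p`. -/
theorem G_pow (g : G F P Ω) : g ^ p = 1 := G_ext fun x hx => by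
  obtain ⟨c, -, hc⟩ := exists_translate g hx
  have key : ∀ n : ℕ, (g ^ n) x = x - n • algebraMap _ (kummerField F P Ω) c := by
    intro n
    induction n with
    | zero => simp
    | succ n ih =>
      rw [pow_succ', AlgEquiv.mul_apply, ih, map_sub, hc, map_nsmul, AlgEquiv.commutes, succ_nsmul]
      abel
  have : CharP Ω p := (Algebra.charP_iff F Ω p).mp inferInstance
  have : CharP (kummerField F P Ω) p :=
    (Algebra.charP_iff (kummerField F P Ω) Ω p).mpr inferInstance
  rw [key, nsmul_eq_mul, CharP.cast_eq_zero, zero_mul, sub_zero]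
  rfl

instance : Module (ZMod p) (Additive (G F P Ω)) :=
  AddCommGroup.zmodModule fun g => G_pow p g.toMul


/-- `σ g σ⁻¹`, for `g ∈ G` and `σ ∈ Gal(L/k)` with restriction `δ` to `K_P`. -/
def conj (δ : Delta F P Ω) (σ : Gal(kummerField F P Ω/RatFunc F))
    (hσ : ∀ c : cyclotomicField F P Ω, σ (algebraMap _ _ c) = algebraMap _ _ (δ c)) :
    G F P Ω →* G F P Ω where
  toFun g :=
    { σ * g.restrictScalars (RatFunc F) * σ⁻¹ with
      commutes' := fun c => by
        have h : σ⁻¹ (algebraMap _ _ c) = algebraMap _ _ (δ⁻¹ c) := by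
          apply σ.injective
          rw [hσ, ← AlgEquiv.mul_apply, ← AlgEquiv.mul_apply, mul_inv_cancel, mul_inv_cancel]
          rfl
        change σ (g (σ⁻¹ (algebraMap _ _ c))) = algebraMap _ _ c
        rw [h, AlgEquiv.commutes, hσ, ← AlgEquiv.mul_apply, mul_inv_cancel]
        rfl }
  map_one' := AlgEquiv.ext fun x => σ.apply_symm_apply x
  map_mul' g h := AlgEquiv.ext fun x => by
    change σ (g (h (σ⁻¹ x))) = σ (g (σ.symm (σ (h (σ⁻¹ x)))))
    rw [σ.symm_apply_apply]

theorem conj_apply (δ : Delta F P Ω) (σ : Gal(kummerField F P Ω/RatFunc F)) (hσ) (g : G F P Ω)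
    (x : kummerField F P Ω) : conj δ σ hσ g x = σ (g (σ.symm x)) := rfl

/-- `σ g σ⁻¹` depends only on `g` and on the restriction of `σ` to `K_P`. -/
theorem conj_congr {δ : Delta F P Ω} {σ τ : Gal(kummerField F P Ω/RatFunc F)} (hσ hτ) :
    conj δ σ hσ = conj δ τ hτ := by
  ext1 g
  let h : G F P Ω :=
    { σ⁻¹ * τ with
      commutes' := fun c => by
        change σ.symm (τ (algebraMap _ _ c)) = _
        rw [hτ, ← hσ, σ.symm_apply_apply] }
  have hh : ∀ x, σ (h x) = τ x := fun x => σ.apply_symm_apply (τ x)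
  ext1 x
  obtain ⟨y, rfl⟩ := τ.surjective x
  rw [conj_apply, conj_apply, τ.symm_apply_apply, ← hh, ← hh, σ.symm_apply_apply,
    ← AlgEquiv.mul_apply, ← AlgEquiv.mul_apply, mul_comm]

variable (F P Ω) in
/-- The inclusion `Λ_P → K_P`. -/
def toK (l : torsion F P Ω) : cyclotomicField F P Ω :=
  ⟨(of F Ω).symm l, IntermediateField.subset_adjoin _ _ l.2⟩

theorem of_toK (l : torsion F P Ω) : of F Ω (toK F P Ω l : Ω) = l := rfl

theorem of_mem_torsion (δ : Delta F P Ω) (l : torsion F P Ω) :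
    of F Ω ((δ (toK F P Ω l) : cyclotomicField F P Ω) : Ω) ∈ torsion F P Ω := by
  rw [mem_torsion, aeval_coe', aeval_algHom_apply δ]
  have : aeval (toK F P Ω l) (phik F P) = 0 :=
    Subtype.ext ((aeval_coe' _ _).symm.trans (mem_torsion.mp l.2))
  rw [this, map_zero]
  rfl

/-- The action of `δ ∈ Δ` on `Λ_P ⊆ K_P`. -/
def torsionMap (δ : Delta F P Ω) : torsion F P Ω →ₗ[F[X]] torsion F P Ω where
  toFun l := ⟨of F Ω ((δ (toK F P Ω l) : cyclotomicField F P Ω) : Ω), of_mem_torsion δ l⟩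
  map_add' l m := Subtype.ext <| congrArg (fun c : cyclotomicField F P Ω => of F Ω (c : Ω))
    (map_add δ (toK F P Ω l) (toK F P Ω m))
  map_smul' a l := Subtype.ext <| by
    change of F Ω ((δ (toK F P Ω (a • l)) : cyclotomicField F P Ω) : Ω) = a • of F Ω _
    have : toK F P Ω (a • l) = aeval (toK F P Ω l) (phik F a) := Subtype.ext <| by
      rw [← aeval_coe']
      exact (of F Ω).injective (smul_of a _)
    rw [this, smul_of, aeval_coe', aeval_algHom_apply δ]

theorem toK_torsionMap (δ : Delta F P Ω) (l : torsion F P Ω) :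
    toK F P Ω (torsionMap δ l) = δ (toK F P Ω l) := rfl

variable (F P Ω) in
/-- `Hom_A(U(A) / P U(A), Λ_P)`. -/
abbrev KummerHom : Type _ := QuotSMulTop P (unitModule F) →ₗ[F[X]] torsion F P Ω

instance : Module (ZMod p) (KummerHom F P Ω) :=
  AddCommGroup.zmodModule (n := p) (G := KummerHom F P Ω) fun f => by
    have : CharP Ω p := (Algebra.charP_iff F Ω p).mp inferInstance
    refine LinearMap.ext fun u => Subtype.ext ((of F Ω).symm.injective ?_)
    have h : ((p • f u : torsion F P Ω) : C F Ω) = p • (f u : C F Ω) :=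
      map_nsmul (torsion F P Ω).subtype p (f u)
    rw [LinearMap.smul_apply, h, map_nsmul, nsmul_eq_mul, CharP.cast_eq_zero, zero_mul]
    rfl

variable (F P Ω) in
/-- The action of `Δ` on `Hom_A(U(A) / P U(A), Λ_P)` through its action on `Λ_P`
(`Δ` fixes `U(A) ⊆ k`), over `𝔽_p`. -/
def homRep : Representation (ZMod p) (Delta F P Ω) (KummerHom F P Ω) where
  toFun δ := AddMonoidHom.toZModLinearMap p
    ((LinearMap.compRight F[X] (torsionMap δ)).toAddMonoidHom)
  map_one' := by ext; rfl
  map_mul' _ _ := by ext; rfl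

variable [Fact (Irreducible P)] [IsAlgClosed Ω]

instance : Normal (RatFunc F) (kummerField F P Ω) :=
  normal_kummerField (Fact.out : Irreducible P).ne_zero

/-- `g ↦ σ g σ⁻¹`, where `σ ∈ Gal(L/k)` is any lift of `δ ∈ Δ`. -/
def deltaConj (δ : Delta F P Ω) : G F P Ω →* G F P Ω :=
  conj δ (δ.liftNormal (kummerField F P Ω)) (δ.liftNormal_commutes _)

theorem deltaConj_eq (δ : Delta F P Ω) (σ : Gal(kummerField F P Ω/RatFunc F)) (hσ) :
    deltaConj δ = conj δ σ hσ := conj_congr _ _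

theorem deltaConj_one : deltaConj (1 : Delta F P Ω) = MonoidHom.id _ := by
  rw [deltaConj_eq 1 1 fun _ => rfl]
  rfl

theorem deltaConj_mul (δ ε : Delta F P Ω) :
    deltaConj (δ * ε) = (deltaConj δ).comp (deltaConj ε) := by
  rw [deltaConj_eq (δ * ε) (δ.liftNormal (kummerField F P Ω) * ε.liftNormal (kummerField F P Ω))
    fun c => by rw [AlgEquiv.mul_apply, AlgEquiv.liftNormal_commutes,
        AlgEquiv.liftNormal_commutes, AlgEquiv.mul_apply]]
  rfl

variable (F P Ω) in
/-- The action of `Δ` on `G` by conjugation with lifts, as a representation over `𝔽_p`. -/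
def galRep : Representation (ZMod p) (Delta F P Ω) (Additive (G F P Ω)) where
  toFun δ := AddMonoidHom.toZModLinearMap p (MonoidHom.toAdditive (deltaConj δ))
  map_one' := by
    rw [deltaConj_one]
    rfl
  map_mul' δ ε := by
    rw [deltaConj_mul]
    rfl

/-- `(δ • g)(σ x) = σ (g x)` for every lift `σ` of `δ`. -/
theorem galRep_apply (δ : Delta F P Ω) (σ : Gal(kummerField F P Ω/RatFunc F))
    (hσ : ∀ c : cyclotomicField F P Ω, σ (algebraMap _ _ c) = algebraMap _ _ (δ c))
    (g : Additive (G F P Ω)) (x : kummerField F P Ω) :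
    (galRep F P Ω p δ g).toMul (σ x) = σ (g.toMul x) := by
  change deltaConj δ g.toMul (σ x) = _
  rw [deltaConj_eq δ σ hσ, conj_apply, σ.symm_apply_apply]

end Fields
end Carlitz

end

/-!
The isomorphism is the Kummer pairing `kummerHom`, `g ↦ (φ_P(z) ↦ z - g z)`. It is well defined
because two solutions `z` of `φ_P(z) = u` differ by an element of `Λ_P ⊆ K_P`, which `g` fixes, and
injective because `L` is generated by `𝔘` over `K_P`. It commutes with `Δ` since `φ_P(z) = u` implies
`φ_P(σ z) = σ u = u` for every lift `σ` of an element of `Δ`.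

For surjectivity, `U(A)` is generated by `1`, so a homomorphism `U(A) / P U(A) → Λ_P` is determined
by its value at the class of `1`, and it suffices that the image is nonzero (`exists_apply_ne`) and
that `Δ` acts transitively on `Λ_P \ {0}` (`exists_torsionMap_eq`).

* Transitivity holds because `φ_P / X` is Eisenstein at `P` (`irreducible_divX_phi`). The divisibility
  of the lower coefficients `c_i` of `X ^ q ^ i` in `φ_P` follows from
  `c_{i+1} (T ^ q ^ (i+1) - T) = c_i ^ q - c_i` and `c_0 = P`, as `P` does not divide
  `T ^ q ^ i - T` for `0 < i < deg P`.
* The image is nonzero because `φ_P(z) = 1` has no solution in `K_P` (`aeval_phik_ne_one_of_mem`).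
  The degree `[K_P : k] = q ^ deg P - 1` is `-1` in `F`, so minus the trace of a solution would be a
  solution in `k`. It would be integral over `A`, hence lie in `A`, but for `q ≥ 3` the elements of
  `φ_P(A)` have positive degree or are zero (`smul_of_ne_one`).
-/

noncomputable section

namespace Carlitz

/-! ### The polynomials `φ_a` -/

section Polynomials

variable {F : Type*} [Field F] [Fintype F]

/-- The `q`-th power of a polynomial, as the substitution `X ↦ X ^ q` together with the
`q`-Frobenius on the coefficients. -/
theorem pow_card_eq_map_expand {R : Type*} [CommRing R] [Algebra F R] (f : R[X]) :
    f ^ Fintype.card F =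
      (expand R (Fintype.card F) f).map (FiniteField.frobeniusAlgHom F R : R →+* R) := by
  nontriviality R
  obtain ⟨p, hp, n, hn, hc⟩ := FiniteField.card' F
  have : Fact p.Prime := ⟨hn⟩
  have : CharP R p := (Algebra.charP_iff F R p).mp hp
  rw [hc, ← map_iterateFrobenius_expand p f n]
  congr 1
  ext x
  simp [iterateFrobenius_def, hc]

theorem coeff_pow_card {R : Type*} [CommRing R] [Algebra F R] (f : R[X]) (n : ℕ) :
    (f ^ Fintype.card F).coeff (n * Fintype.card F) = f.coeff n ^ Fintype.card F := by
  rw [pow_card_eq_map_expand, coeff_map, coeff_expand_mul Fintype.card_pos]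
  rfl

theorem coeff_pow_card_of_not_dvd {R : Type*} [CommRing R] [Algebra F R] (f : R[X]) {n : ℕ}
    (hn : ¬ Fintype.card F ∣ n) : (f ^ Fintype.card F).coeff n = 0 := by
  rw [pow_card_eq_map_expand, coeff_map, coeff_expand Fintype.card_pos, if_neg hn, map_zero]

theorem phi_add (a b : F[X]) : phi (a + b) = phi a + phi b := by simp [phi, add_smul]

theorem phi_C (c : F) : phi (Polynomial.C c) = Polynomial.C (Polynomial.C c) * X := by
  simp [phi, C_smul_of, Algebra.smul_def]

theorem phi_X_mul (a : F[X]) :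
    phi (X * a) = (X : F[X]) • phi a + phi a ^ Fintype.card F := by
  rw [phi, mul_smul, ← (of F F[X][X]).apply_symm_apply (a • of F F[X][X] X), X_smul_of]
  rfl

theorem phi_X_mul_add_C (a : F[X]) (c : F) : phi (X * a + Polynomial.C c) =
    (X : F[X]) • phi a + phi a ^ Fintype.card F + Polynomial.C (Polynomial.C c) * X := by
  rw [phi_add, phi_X_mul, phi_C]

/-- Horner's induction principle. -/
theorem induction_X_mul_add_C {motive : F[X] → Prop} (zero : motive 0)
    (step : ∀ a c, motive a → motive (X * a + Polynomial.C c)) (a : F[X]) : motive a := by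
  induction h : a.natDegree using Nat.strong_induction_on generalizing a with
  | _ n ih =>
    subst h
    by_cases ha : a.natDegree = 0
    · have := step 0 (a.coeff 0) zero
      rwa [mul_zero, zero_add, ← eq_C_of_natDegree_eq_zero ha] at this
    · rw [← X_mul_divX_add a]
      exact step _ _ (ih _ (by rw [natDegree_divX_eq_natDegree_tsub_one]; lia) _ rfl)

/-- Only the exponents `q ^ i` occur in `φ_a`. -/
theorem exists_eq_pow_of_coeff_phi_ne_zero (a : F[X]) {m : ℕ} (hm : (phi a).coeff m ≠ 0) :
    ∃ i, m = Fintype.card F ^ i := by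
  induction a using induction_X_mul_add_C generalizing m with
  | zero => simp [phi] at hm
  | step a c ih =>
    rw [phi_X_mul_add_C, coeff_add, coeff_add, coeff_smul, smul_eq_mul, coeff_C_mul] at hm
    by_cases h1 : (phi a).coeff m = 0
    · by_cases h2 : (phi a ^ Fintype.card F).coeff m = 0
      · refine ⟨0, ?_⟩
        by_contra h
        rw [pow_zero] at h
        simp [h1, h2, coeff_X, Ne.symm h] at hm
      · obtain ⟨n, rfl⟩ : Fintype.card F ∣ m := by
          by_contra h
          exact h2 (coeff_pow_card_of_not_dvd _ h)
        rw [mul_comm, coeff_pow_card] at h2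
        obtain ⟨i, rfl⟩ := ih (fun h => h2 (by rw [h, zero_pow Fintype.card_ne_zero]))
        exact ⟨i + 1, (pow_succ' _ _).symm⟩
    · exact ih h1

theorem coeff_one_phi (a : F[X]) : (phi a).coeff 1 = a := by
  have h := congrArg (coeff · 0) (derivative_phi a)
  simpa [coeff_derivative] using h

theorem coeff_phi_X_mul_add_C (a : F[X]) (c : F) (i : ℕ) :
    (phi (X * a + Polynomial.C c)).coeff (Fintype.card F ^ (i + 1)) =
      X * (phi a).coeff (Fintype.card F ^ (i + 1)) +
        (phi a).coeff (Fintype.card F ^ i) ^ Fintype.card F := by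
  have : Fintype.card F ^ (i + 1) ≠ 1 := (Nat.one_lt_pow (by lia) Fintype.one_lt_card).ne'
  rw [phi_X_mul_add_C, coeff_add, coeff_add, coeff_smul, smul_eq_mul, coeff_C_mul, coeff_X,
    if_neg this.symm, mul_zero, add_zero]
  conv_lhs => enter [2]; rw [pow_succ, coeff_pow_card]

/-- The relation between consecutive coefficients of `φ_a` that expresses `φ_a φ_T = φ_T φ_a`. -/
theorem coeff_phi_succ_mul (a : F[X]) (i : ℕ) :
    (phi a).coeff (Fintype.card F ^ (i + 1)) * (X ^ Fintype.card F ^ (i + 1) - X) =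
      (phi a).coeff (Fintype.card F ^ i) ^ Fintype.card F -
        (phi a).coeff (Fintype.card F ^ i) := by
  have hsub : ∀ f g : F[X], (f - g) ^ Fintype.card F = f ^ Fintype.card F - g ^ Fintype.card F :=
    map_sub (FiniteField.frobeniusAlgHom F F[X])
  have hadd : ∀ f g : F[X], (f + g) ^ Fintype.card F = f ^ Fintype.card F + g ^ Fintype.card F :=
    map_add (FiniteField.frobeniusAlgHom F F[X])
  induction a using induction_X_mul_add_C generalizing i with
  | zero => simp [phi, Fintype.card_ne_zero]
  | step a c ih =>
    rw [coeff_phi_X_mul_add_C, add_mul, mul_assoc, ih]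
    cases i with
    | zero =>
      rw [pow_zero, coeff_one_phi, coeff_one_phi, hadd, ← map_pow, FiniteField.pow_card]
      ring
    | succ i =>
      have h := congrArg (· ^ Fintype.card F) (ih i)
      simp only [mul_pow, hsub, ← pow_mul, ← pow_succ] at h
      rw [coeff_phi_X_mul_add_C, hadd, mul_pow, ← pow_mul]
      linear_combination h

/-- The coefficient of `X ^ q ^ n` in `φ_a` for `deg a ≤ n`; in particular `φ_a` has degree
`q ^ deg a` and the leading coefficient of `a`. -/
theorem coeff_phi_of_natDegree_le (a : F[X]) {n : ℕ} (ha : a.natDegree ≤ n) :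
    (phi a).coeff (Fintype.card F ^ n) = Polynomial.C (a.coeff n) := by
  -- The induction step uses the coefficients at both `n` and `n + 1` of the quotient of `a` by `T`,
  -- so the bound on the degree has to vary independently of `n`.
  obtain ⟨N, ha, hn⟩ : ∃ N, a.natDegree ≤ N ∧ N ≤ n := ⟨n, ha, le_rfl⟩
  induction N generalizing a n with
  | zero =>
    obtain ⟨c, rfl⟩ : ∃ c, a = Polynomial.C c := ⟨_, eq_C_of_natDegree_le_zero ha⟩
    rw [phi_C, coeff_C_mul, coeff_X, coeff_C]
    have := Fintype.one_lt_card (α := F)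
    by_cases h : n = 0
    · simp [h]
    · simp [h, (Nat.one_lt_pow h this).ne]
  | succ N ih =>
    obtain ⟨n, rfl⟩ : ∃ m, n = m + 1 := ⟨n - 1, by lia⟩
    have hd : a.divX.natDegree ≤ N := by rw [natDegree_divX_eq_natDegree_tsub_one]; lia
    conv_lhs => rw [← X_mul_divX_add a]
    rw [coeff_phi_X_mul_add_C, ih a.divX (n := n + 1) (by lia) hd (by lia),
      ih a.divX (n := n) (by lia) hd (by lia),
      coeff_eq_zero_of_natDegree_lt (by lia : a.divX.natDegree < n + 1), ← map_pow,
      FiniteField.pow_card, coeff_divX, Polynomial.C_0, mul_zero, zero_add]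

theorem natDegree_phi {a : F[X]} (ha : a ≠ 0) :
    (phi a).natDegree = Fintype.card F ^ a.natDegree := by
  refine natDegree_eq_of_le_of_coeff_ne_zero (natDegree_le_iff_coeff_eq_zero.2 fun m hm => ?_) ?_
  · by_contra h
    obtain ⟨i, rfl⟩ := exists_eq_pow_of_coeff_phi_ne_zero a h
    rw [Nat.pow_lt_pow_iff_right Fintype.one_lt_card] at hm
    rw [coeff_phi_of_natDegree_le a hm.le, coeff_eq_zero_of_natDegree_lt hm,
      Polynomial.C_0] at h
    exact h rfl
  · rw [coeff_phi_of_natDegree_le a le_rfl]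
    simpa using ha

theorem monic_phi {a : F[X]} (ha : a.Monic) : (phi a).Monic := by
  rw [Monic, leadingCoeff, natDegree_phi ha.ne_zero, coeff_phi_of_natDegree_le a le_rfl,
    coeff_natDegree, ha.leadingCoeff, Polynomial.C_1]

/-- `φ_P` is congruent to `X ^ q ^ d` modulo the irreducible polynomial `P` of degree `d`. -/
theorem dvd_coeff_phi {P : F[X]} (hP : Irreducible P) {m : ℕ}
    (hm : m < Fintype.card F ^ P.natDegree) : P ∣ (phi P).coeff m := by
  by_cases h0 : (phi P).coeff m = 0
  · simp [h0]
  obtain ⟨i, rfl⟩ := exists_eq_pow_of_coeff_phi_ne_zero P h0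
  rw [Nat.pow_lt_pow_iff_right Fintype.one_lt_card] at hm
  clear h0
  induction i with
  | zero => simp [coeff_one_phi]
  | succ i ih =>
    have h := coeff_phi_succ_mul P i
    have hi := ih (by lia)
    have hdvd : P ∣ (phi P).coeff (Fintype.card F ^ (i + 1)) *
        (X ^ Fintype.card F ^ (i + 1) - X) := by
      rw [h]
      exact dvd_sub (dvd_pow hi Fintype.card_ne_zero) hi
    -- `P` does not divide `T ^ q ^ (i + 1) - T`, because `i + 1 < deg P`.
    refine (hP.prime.dvd_or_dvd hdvd).resolve_right fun h => ?_
    rw [← Nat.card_eq_fintype_card] at h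
    have := Nat.le_of_dvd (by lia) (hP.natDegree_dvd_of_dvd_X_pow_card_pow_sub_X h)
    lia

theorem X_mul_divX_phi (a : F[X]) : X * (phi a).divX = phi a := by
  have h : (phi a).coeff 0 = 0 := by
    by_contra h
    obtain ⟨i, hi⟩ := exists_eq_pow_of_coeff_phi_ne_zero a h
    exact (pow_ne_zero i Fintype.card_ne_zero) hi.symm
  simpa [h] using X_mul_divX_add (phi a)

theorem monic_divX_phi {a : F[X]} (ha : a.Monic) : (phi a).divX.Monic :=
  Monic.of_mul_monic_left monic_X (by rw [X_mul_divX_phi]; exact monic_phi ha)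

/-- `φ_P / X` is Eisenstein at `P`. -/
theorem irreducible_divX_phi {P : F[X]} (hP : Irreducible P) (hP1 : P.Monic) :
    Irreducible (phi P).divX := by
  have hprime : (Ideal.span {P}).IsPrime := (Ideal.span_singleton_prime hP.ne_zero).2 hP.prime
  have hd : (phi P).divX.natDegree = Fintype.card F ^ P.natDegree - 1 := by
    rw [natDegree_divX_eq_natDegree_tsub_one, natDegree_phi hP.ne_zero]
  have hE : (phi P).divX.IsEisensteinAt (Ideal.span {P}) := by
    refine (monic_divX_phi hP1).isEisensteinAt_of_mem_of_notMem hprime.ne_top ?_ ?_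
    · intro n hn
      rw [Ideal.mem_span_singleton, coeff_divX]
      exact dvd_coeff_phi hP (by lia)
    · rw [Ideal.span_singleton_pow, Ideal.mem_span_singleton, coeff_divX, zero_add, coeff_one_phi]
      intro h
      exact hP.not_isUnit (isUnit_of_dvd_one ((mul_dvd_mul_iff_left hP.ne_zero).1
        (by rwa [mul_one, ← sq])))
  refine hE.irreducible hprime (monic_divX_phi hP1).isPrimitive ?_
  have := Nat.one_lt_pow hP.natDegree_pos.ne' (Fintype.one_lt_card (α := F))
  lia

theorem irreducible_divX_phik {P : F[X]} (hP : Irreducible P) (hP1 : P.Monic) :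
    Irreducible ((phi P).divX.map (algebraMap F[X] (RatFunc F))) :=
  (monic_divX_phi hP1).irreducible_iff_irreducible_map_fraction_map.1 (irreducible_divX_phi hP hP1)

/-- `T` raises degrees in `C(A)`. For `q = 2` this is false, as `φ_T(T) = 0` and
`φ_T(T + 1) = T + 1`. -/
theorem natDegree_lt_natDegree_phiT (hq : 3 ≤ Fintype.card F) {v : F[X]} (hv : v ≠ 0) :
    v.natDegree < (X * v + v ^ Fintype.card F).natDegree := by
  by_cases h : v.natDegree = 0
  · obtain ⟨c, rfl⟩ : ∃ c, v = Polynomial.C c := ⟨_, eq_C_of_natDegree_eq_zero h⟩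
    have hc : c ≠ 0 := fun hc => hv (by rw [hc, Polynomial.C_0])
    rw [← map_pow, FiniteField.pow_card, mul_comm, natDegree_add_C, natDegree_C_mul hc]
    simp
  · have hlt : (X * v).natDegree < (v ^ Fintype.card F).natDegree := by
      rw [natDegree_X_mul hv, natDegree_pow]
      nlinarith [Nat.pos_of_ne_zero h]
    rw [natDegree_add_eq_right_of_natDegree_lt hlt, natDegree_pow]
    nlinarith [Nat.pos_of_ne_zero h]

/-- Nonzero elements of `A` do not lower degrees in `C(A)`, and nonconstant ones raise them. -/
theorem natDegree_smul_of (hq : 3 ≤ Fintype.card F) {w : F[X]} (hw : w ≠ 0) {a : F[X]}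
    (ha : a ≠ 0) :
    (of F F[X]).symm (a • of F F[X] w) ≠ 0 ∧
      w.natDegree ≤ ((of F F[X]).symm (a • of F F[X] w)).natDegree ∧
      (0 < a.natDegree → w.natDegree < ((of F F[X]).symm (a • of F F[X] w)).natDegree) := by
  induction a using induction_X_mul_add_C with
  | zero => exact absurd rfl ha
  | step a c ih =>
    by_cases h0 : a = 0
    · have hc : c ≠ 0 := by
        rintro rfl
        simp [h0] at ha
      simp [h0, C_smul_of, hw, hc, natDegree_smul _ hc]
    · obtain ⟨h1, h2, -⟩ := ih h0
      rw [add_smul, mul_smul, C_smul_of]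
      set v := (of F F[X]).symm (a • of F F[X] w) with hv
      rw [← (of F F[X]).apply_symm_apply (a • of F F[X] w), ← hv, X_smul_of, ← map_add,
        AddEquiv.symm_apply_apply, smul_eq_mul]
      have h3 := natDegree_lt_natDegree_phiT hq h1
      have h4 : (c • w).natDegree < (X * v + v ^ Fintype.card F).natDegree :=
        (natDegree_smul_le c w).trans_lt (h2.trans_lt h3)
      have h5 := natDegree_add_eq_left_of_natDegree_lt h4
      have h6 : w.natDegree < (X * v + v ^ Fintype.card F + c • w).natDegree := by
        rw [h5]; exact h2.trans_lt h3
      refine ⟨fun h => ?_, h6.le, fun _ => h6⟩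
      rw [h, natDegree_zero] at h6
      exact Nat.not_lt_zero _ h6

/-- `1 ∈ C(A)` is not divisible by a nonconstant `a` if `q ≥ 3`. This fails for `q = 2`:
then `T ^ 2 + T` kills `1`, so that `1 = (T ^ 2 + T + 1) • 1`. -/
theorem smul_of_ne_one (hq : 3 ≤ Fintype.card F) {a : F[X]} (ha : 0 < a.natDegree) (w : F[X]) :
    a • of F F[X] w ≠ of F F[X] 1 := by
  intro h
  by_cases hw : w = 0
  · rw [hw, map_zero, smul_zero] at h
    exact one_ne_zero ((of F F[X]).injective (h.symm.trans (map_zero _).symm))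
  · have := (natDegree_smul_of hq hw (by rintro rfl; simp at ha)).2.2 ha
    rw [h, AddEquiv.symm_apply_apply, natDegree_one] at this
    exact Nat.not_lt_zero _ this

end Polynomials

/-! ### The field `K_P` -/

section Cyclotomic

variable {F : Type*} [Field F] [Fintype F] {P : F[X]}
  {Ω : Type*} [Field Ω] [Algebra F Ω] [Algebra F[X] Ω] [Algebra (RatFunc F) Ω]
  [IsScalarTower F F[X] Ω] [IsScalarTower F[X] (RatFunc F) Ω]

theorem X_mul_divX_phik (a : F[X]) :
    X * (phi a).divX.map (algebraMap F[X] (RatFunc F)) = phik F a := by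
  conv_rhs => rw [phik, ← X_mul_divX_phi, Polynomial.map_mul, map_X]

theorem aeval_divX_phi {x : Ω} (hx : of F Ω x ∈ torsion F P Ω) (h0 : x ≠ 0) :
    aeval x ((phi P).divX.map (algebraMap F[X] (RatFunc F))) = 0 := by
  rw [mem_torsion, ← X_mul_divX_phik, map_mul, aeval_X] at hx
  exact (mul_eq_zero.1 hx).resolve_left h0

theorem minpoly_eq_divX_phi (hP : Irreducible P) (hP1 : P.Monic) {x : Ω}
    (hx : of F Ω x ∈ torsion F P Ω) (h0 : x ≠ 0) :
    minpoly (RatFunc F) x = (phi P).divX.map (algebraMap F[X] (RatFunc F)) :=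
  (minpoly.eq_of_irreducible_of_monic (irreducible_divX_phik hP hP1) (aeval_divX_phi hx h0)
    ((monic_divX_phi hP1).map _)).symm

theorem isSeparable_of_aeval_phik (hP : P ≠ 0) {x : Ω} {c : RatFunc F}
    (hx : aeval x (phik F P) = algebraMap (RatFunc F) Ω c) : IsSeparable (RatFunc F) x :=
  (separable_phik_sub hP c).of_dvd (minpoly.dvd _ _ (by rw [map_sub, hx, aeval_C, sub_self]))

theorem isSeparable_cyclotomicField (hP : P ≠ 0) :
    Algebra.IsSeparable (RatFunc F) (cyclotomicField F P Ω) :=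
  (IntermediateField.isSeparable_adjoin_iff_isSeparable _ _).2 fun x hx =>
    isSeparable_of_aeval_phik (c := 0) hP (by rw [mem_torsion.1 hx, map_zero])

theorem normal_cyclotomicField [IsAlgClosed Ω] (hP : P ≠ 0) :
    Normal (RatFunc F) (cyclotomicField F P Ω) := by
  have h := normal_of_sets (Ω := Ω) hP {0}
  have hset : {x : Ω | ∃ c ∈ ({0} : Set (RatFunc F)), aeval x (phik F P) = algebraMap _ Ω c} =
      {x | of F Ω x ∈ torsion F P Ω} := by
    ext x
    simp only [Set.mem_ofPred_eq, Set.mem_singleton_iff, exists_eq_left, map_zero, mem_torsion]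
  rwa [hset] at h

/-- `Λ_P` is generated as an `A`-module by each of its nonzero elements: it has at most
`deg φ_P = q ^ deg P` elements, and the residue classes modulo `P` give that many multiples. -/
theorem exists_smul_eq_of_mem_torsion (hP : Irreducible P) {x y : Ω}
    (hx : of F Ω x ∈ torsion F P Ω) (h0 : x ≠ 0) (hy : of F Ω y ∈ torsion F P Ω) :
    ∃ a : F[X], a • of F Ω x = of F Ω y := by
  have hne : phik F P ≠ 0 := by simpa using (separable_phik_sub hP.ne_zero 0).ne_zero
  let f : degreeLT F P.natDegree → (phik F P).rootSet Ω := fun a =>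
    ⟨(of F Ω).symm ((a : F[X]) • of F Ω x), mem_rootSet.2 ⟨hne, mem_torsion.1
      (by rw [AddEquiv.apply_symm_apply]; exact Submodule.smul_mem _ _ hx)⟩⟩
  have hf : Function.Injective f := by
    intro a b hab
    have h1 : ((a : F[X]) - b) • of F Ω x = 0 := by
      rw [sub_smul, sub_eq_zero]
      exact (of F Ω).symm.injective (congrArg Subtype.val hab)
    by_contra hne
    have hdeg : (((a - b : degreeLT F P.natDegree)) : F[X]).degree < P.natDegree :=
      mem_degreeLT.1 (a - b).2
    have hc : IsCoprime P ((a : F[X]) - b) := (hP.coprime_iff_not_dvd).2 fun hdvd => by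
      have h2 : ((a : F[X]) - b) ≠ 0 := sub_ne_zero.2 fun h => hne (Subtype.ext h)
      have := degree_le_of_dvd hdvd h2
      rw [degree_eq_natDegree hP.ne_zero] at this
      exact absurd hdeg (not_lt.2 this)
    obtain ⟨u, v, huv⟩ := hc
    have h2 : P • of F Ω x = 0 := hx
    have h3 : of F Ω x = 0 := by
      rw [← one_smul F[X] (of F Ω x), ← huv, add_smul, mul_smul, mul_smul, h1, h2, smul_zero,
        smul_zero, add_zero]
    exact h0 ((of F Ω).injective (h3.trans (map_zero _).symm))
  have hcard : Nat.card ((phik F P).rootSet Ω) ≤ Nat.card (degreeLT F P.natDegree) := by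
    rw [Nat.card_congr (degreeLTEquiv F P.natDegree).toEquiv, Nat.card_fun, Nat.card_fin,
      Nat.card_eq_fintype_card (α := F)]
    have h1 := ncard_rootSet_le (phik F P) Ω
    rw [natDegree_map_eq_of_injective (FaithfulSMul.algebraMap_injective _ _),
      natDegree_phi hP.ne_zero] at h1
    exact h1
  have : Finite ((phik F P).rootSet Ω) := (rootSet_finite _ _)
  obtain ⟨a, ha⟩ := (hf.bijective_of_nat_card_le hcard).2 ⟨y, mem_rootSet.2 ⟨hne, mem_torsion.1 hy⟩⟩
  exact ⟨a, (of F Ω).symm.injective (congrArg Subtype.val ha)⟩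

theorem cyclotomicField_eq_adjoin (hP : Irreducible P) {x : Ω}
    (hx : of F Ω x ∈ torsion F P Ω) (h0 : x ≠ 0) :
    cyclotomicField F P Ω = IntermediateField.adjoin (RatFunc F) {x} := by
  refine le_antisymm (IntermediateField.adjoin_le_iff.2 fun y hy => ?_)
    (IntermediateField.adjoin.mono _ _ _ (Set.singleton_subset_iff.2 hx))
  obtain ⟨a, ha⟩ := exists_smul_eq_of_mem_torsion hP hx h0 hy
  rw [smul_of] at ha
  rw [← (of F Ω).injective ha]
  exact aeval_algebraMap_apply Ω (IntermediateField.AdjoinSimple.gen (RatFunc F) x) (phik F a) ▸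
    SetLike.coe_mem _

theorem exists_mem_torsion_ne_zero [IsAlgClosed Ω] (hP : Irreducible P) (hP1 : P.Monic) :
    ∃ x : Ω, of F Ω x ∈ torsion F P Ω ∧ x ≠ 0 := by
  have hirr := irreducible_divX_phik hP hP1
  obtain ⟨x, hx⟩ := IsAlgClosed.exists_aeval_eq_zero Ω _ (degree_pos_of_irreducible hirr).ne'
  refine ⟨x, mem_torsion.2 (by rw [← X_mul_divX_phik, map_mul, hx, mul_zero]), ?_⟩
  rintro rfl
  rw [← coeff_zero_eq_aeval_zero', coeff_map, coeff_divX, zero_add, coeff_one_phi,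
    map_eq_zero, map_eq_zero_iff _ (FaithfulSMul.algebraMap_injective _ _)] at hx
  exact hP.ne_zero hx

theorem finrank_cyclotomicField [IsAlgClosed Ω] (hP : Irreducible P) (hP1 : P.Monic) :
    Module.finrank (RatFunc F) (cyclotomicField F P Ω) = Fintype.card F ^ P.natDegree - 1 := by
  obtain ⟨x, hx, h0⟩ := exists_mem_torsion_ne_zero (Ω := Ω) hP hP1
  have hint : IsIntegral (RatFunc F) x := ⟨_, (monic_divX_phi hP1).map _, aeval_divX_phi hx h0⟩
  rw [cyclotomicField_eq_adjoin hP hx h0, IntermediateField.adjoin.finrank hint,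
    minpoly_eq_divX_phi hP hP1 hx h0, (monic_divX_phi hP1).natDegree_map,
    natDegree_divX_eq_natDegree_tsub_one, natDegree_phi hP.ne_zero]

/-- `Δ` acts transitively on `Λ_P \ {0}`, because `φ_P / X` is irreducible over `k`. -/
theorem exists_torsionMap_eq [IsAlgClosed Ω] (hP : Irreducible P) (hP1 : P.Monic)
    {l m : torsion F P Ω} (hl : l ≠ 0) (hm : m ≠ 0) :
    ∃ δ : Delta F P Ω, torsionMap δ l = m := by
  have := normal_cyclotomicField (Ω := Ω) hP.ne_zero
  have key : ∀ l : torsion F P Ω, l ≠ 0 → minpoly (RatFunc F) (toK F P Ω l) =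
      (phi P).divX.map (algebraMap F[X] (RatFunc F)) := fun l hl => by
    rw [← minpoly_eq_divX_phi hP hP1 (x := (of F Ω).symm l) l.2 fun h => hl (Subtype.ext
      ((of F Ω).symm.injective h))]
    exact (minpoly.algebraMap_eq (FaithfulSMul.algebraMap_injective (cyclotomicField F P Ω) Ω)
      (toK F P Ω l)).symm
  obtain ⟨δ, hδ⟩ := (Normal.minpoly_eq_iff_mem_orbit _).1 ((key m hm).trans (key l hl).symm)
  exact ⟨δ, Subtype.ext (congrArg (fun c : cyclotomicField F P Ω => of F Ω (c : Ω)) hδ)⟩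

/-- `1` is not divisible by `P` in `C(k)`: a quotient would be integral over `A`. -/
theorem aeval_phik_ne_one (hq : 3 ≤ Fintype.card F) (hP : Irreducible P) (hP1 : P.Monic)
    (w : RatFunc F) : aeval w (phik F P) ≠ 1 := by
  intro h
  have hdeg : 1 < (phi P).natDegree := by
    rw [natDegree_phi hP.ne_zero]
    exact Nat.one_lt_pow hP.natDegree_pos.ne' Fintype.one_lt_card
  have hint : IsIntegral F[X] w := ⟨phi P - Polynomial.C 1,
    (monic_phi hP1).sub_of_left (degree_C_le.trans_lt (natDegree_pos_iff_degree_pos.1 (by lia))), by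
      rw [← aeval_def, map_sub, aeval_C, map_one, ← aeval_map_algebraMap (RatFunc F), h, sub_self]⟩
  obtain ⟨v, rfl⟩ := IsIntegrallyClosed.isIntegral_iff.1 hint
  refine smul_of_ne_one hq hP.natDegree_pos v ((of F F[X]).symm.injective ?_)
  rw [← aeval_phi, AddEquiv.symm_apply_apply]
  apply FaithfulSMul.algebraMap_injective F[X] (RatFunc F)
  rw [map_one, ← h, aeval_map_algebraMap, aeval_algebraMap_apply]

/-- `1` is not divisible by `P` in `C(K_P)`: as `[K_P : k] = q ^ d - 1 = -1` in `F`, minus the trace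
of a quotient would be a quotient in `C(k)`. -/
theorem aeval_phik_ne_one_of_mem [IsAlgClosed Ω] (hq : 3 ≤ Fintype.card F) (hP : Irreducible P)
    (hP1 : P.Monic) (z : cyclotomicField F P Ω) : aeval z (phik F P) ≠ 1 := by
  intro h
  have := normal_cyclotomicField (Ω := Ω) hP.ne_zero
  have := isSeparable_cyclotomicField (Ω := Ω) hP.ne_zero
  have : IsGalois (RatFunc F) (cyclotomicField F P Ω) := ⟨⟩
  have hfin := finrank_cyclotomicField (Ω := Ω) hP hP1
  have hlt := Nat.one_lt_pow hP.natDegree_pos.ne' (Fintype.one_lt_card (α := F))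
  have : FiniteDimensional (RatFunc F) (cyclotomicField F P Ω) :=
    Module.finite_of_finrank_pos (by lia)
  have hsum : P • of F Ω (∑ δ : Delta F P Ω, (δ z : Ω)) =
      of F Ω (∑ _δ : Delta F P Ω, 1) := by
    rw [map_sum, map_sum, Finset.smul_sum]
    refine Finset.sum_congr rfl fun δ _ => ?_
    rw [smul_of, aeval_coe', aeval_algHom_apply δ, h, map_one]
    rfl
  refine aeval_phik_ne_one hq hP hP1 (-Algebra.trace (RatFunc F) _ z) ?_
  have htr : algebraMap (RatFunc F) Ω (Algebra.trace (RatFunc F) _ z) =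
      ∑ δ : Delta F P Ω, (δ z : Ω) := by
    have := congrArg (algebraMap (cyclotomicField F P Ω) Ω)
      (trace_eq_sum_automorphisms (K := RatFunc F) z)
    rwa [← IsScalarTower.algebraMap_apply, map_sum] at this
  apply (algebraMap (RatFunc F) Ω).injective
  apply (of F Ω).injective
  rw [← aeval_algebraMap_apply, ← smul_of, map_neg, map_neg, smul_neg, htr, hsum, map_one,
    ← map_neg, Finset.sum_const, Finset.card_univ, ← Nat.card_eq_fintype_card,
    IsGalois.card_aut_eq_finrank, hfin, nsmul_one, Nat.cast_sub hlt.le, Nat.cast_pow,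
    ← map_natCast (algebraMap F Ω), FiniteField.cast_card_eq_zero, map_zero,
    zero_pow hP.natDegree_pos.ne', Nat.cast_one, zero_sub, neg_neg]

end Cyclotomic

/-! ### The Kummer pairing -/

section Kummer

variable {F : Type*} [Field F] [Fintype F] {P : F[X]}
  {Ω : Type*} [Field Ω] [Algebra F Ω] [Algebra F[X] Ω] [Algebra (RatFunc F) Ω]
  [IsScalarTower F F[X] Ω] [IsScalarTower F[X] (RatFunc F) Ω]

theorem incl_eq_of_algebraMap (v : C F F[X]) : incl F Ω v =
    of F Ω (algebraMap (RatFunc F) Ω (algebraMap F[X] (RatFunc F) ((of F F[X]).symm v))) := by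
  rw [← IsScalarTower.algebraMap_apply]
  rfl

theorem mem_divisionModule_of_smul_eq {x : Ω} {u : unitModule F}
    (h : P • of F Ω x = incl F Ω u) : of F Ω x ∈ divisionModule F P Ω :=
  ⟨u, u.2, h.symm⟩

/-- `Gal(L/k)` permutes the solutions `x` of `φ_P(x) = v`. -/
theorem smul_of_apply {x : kummerField F P Ω} {v : C F F[X]}
    (σ : Gal(kummerField F P Ω/RatFunc F)) (h : P • of F Ω (x : Ω) = incl F Ω v) :
    P • of F Ω ((σ x : kummerField F P Ω) : Ω) = incl F Ω v := by
  rw [smul_of, incl_eq_of_algebraMap] at h ⊢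
  exact congrArg (of F Ω) (aeval_map_coe σ ((of F Ω).injective h))

theorem of_sub_apply_add (g : G F P Ω) (x y : kummerField F P Ω) :
    of F Ω ((x + y - g (x + y) : kummerField F P Ω) : Ω) =
      of F Ω ((x - g x : kummerField F P Ω) : Ω) +
        of F Ω ((y - g y : kummerField F P Ω) : Ω) := by
  rw [← map_add, map_add, add_sub_add_comm]
  rfl

theorem of_sub_apply_aeval (g : G F P Ω) (a : F[X]) (x : kummerField F P Ω) :
    of F Ω ((aeval x (phik F a) - g (aeval x (phik F a)) : kummerField F P Ω) : Ω) =
      a • of F Ω ((x - g x : kummerField F P Ω) : Ω) := by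
  have h1 : ∀ y : kummerField F P Ω,
      a • of F Ω (y : Ω) = of F Ω ((aeval y (phik F a) : kummerField F P Ω) : Ω) := fun y => by
    rw [smul_of, aeval_coe]
  have h2 : g (aeval x (phik F a)) = aeval (g x) (phik F a) :=
    (aeval_algHom_apply (g.restrictScalars (RatFunc F)) x (phik F a)).symm
  have h3 : ∀ y z : kummerField F P Ω, of F Ω ((y - z : kummerField F P Ω) : Ω) =
      of F Ω (y : Ω) - of F Ω (z : Ω) := fun y z => map_sub (of F Ω) _ _
  rw [h2, h3, h3, smul_sub, h1, h1]

/-- `G` fixes `Λ_P`. -/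
theorem of_sub_apply_eq_zero (g : G F P Ω) {x : kummerField F P Ω}
    (hx : of F Ω (x : Ω) ∈ torsion F P Ω) :
    of F Ω ((x - g x : kummerField F P Ω) : Ω) = 0 := by
  have : g x = x := g.commutes ⟨x, IntermediateField.subset_adjoin _ _ hx⟩
  rw [this, sub_self]
  exact map_zero (of F Ω)

/-- `z - g z` depends only on `φ_P(z)`. -/
theorem of_sub_apply_eq (g : G F P Ω) {x y : kummerField F P Ω}
    (h : P • of F Ω (x : Ω) = P • of F Ω (y : Ω)) :
    of F Ω ((x - g x : kummerField F P Ω) : Ω) =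
      of F Ω ((y - g y : kummerField F P Ω) : Ω) := by
  have hxy : of F Ω ((x - y : kummerField F P Ω) : Ω) ∈ torsion F P Ω := by
    have : of F Ω ((x - y : kummerField F P Ω) : Ω) = of F Ω (x : Ω) - of F Ω (y : Ω) :=
      map_sub (of F Ω) _ _
    rw [Submodule.mem_torsionBy_iff, this, smul_sub, h, sub_self]
  rw [← zero_add (of F Ω ((y - g y : kummerField F P Ω) : Ω)), ← of_sub_apply_eq_zero g hxy,
    ← of_sub_apply_add, sub_add_cancel]

variable [IsAlgClosed Ω] [hPi : Fact (Irreducible P)]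

theorem exists_smul_eq_incl (u : unitModule F) :
    ∃ z : kummerField F P Ω, P • of F Ω (z : Ω) = incl F Ω u := by
  set c := algebraMap F[X] (RatFunc F) ((of F F[X]).symm u)
  have hdeg : (phik F P - Polynomial.C c).degree ≠ 0 := by
    have h1 : 0 < (phik F P - Polynomial.C c).natDegree := by
      rw [natDegree_sub_C, natDegree_map_eq_of_injective (FaithfulSMul.algebraMap_injective _ _),
        natDegree_phi hPi.out.ne_zero]
      exact pow_pos Fintype.card_pos _
    exact (natDegree_pos_iff_degree_pos.1 h1).ne'
  obtain ⟨x, hx⟩ := IsAlgClosed.exists_aeval_eq_zero Ω _ hdeg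
  rw [map_sub, aeval_C, sub_eq_zero] at hx
  have h : P • of F Ω x = incl F Ω u := by rw [smul_of, hx, incl_eq_of_algebraMap]
  exact ⟨⟨x, IntermediateField.subset_adjoin _ _ (mem_divisionModule_of_smul_eq h)⟩, h⟩

/-- A `P`-th division value of `u ∈ U(A)`, that is, some `z` with `φ_P(z) = u`. -/
def divisionValue (u : unitModule F) : kummerField F P Ω := (exists_smul_eq_incl u).choose

theorem smul_divisionValue (u : unitModule F) :
    P • of F Ω ((divisionValue u : kummerField F P Ω) : Ω) = incl F Ω u :=
  (exists_smul_eq_incl u).choose_spec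

/-- The homomorphism `U(A) → Λ_P` that sends `φ_P(z)` to `z - g z`. -/
def kummerLinearMap (g : G F P Ω) : unitModule F →ₗ[F[X]] torsion F P Ω where
  toFun u := ⟨_, sub_mem_torsion g (mem_divisionModule_of_smul_eq (smul_divisionValue u))⟩
  map_add' u v := Subtype.ext <| by
    refine Eq.trans (of_sub_apply_eq g ?_) (of_sub_apply_add g _ _)
    have : of F Ω ((divisionValue u + divisionValue v : kummerField F P Ω) : Ω) =
        of F Ω ((divisionValue u : kummerField F P Ω) : Ω) +
          of F Ω ((divisionValue v : kummerField F P Ω) : Ω) := map_add (of F Ω) _ _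
    rw [this, smul_add, smul_divisionValue, smul_divisionValue, smul_divisionValue, ← map_add]
    rfl
  map_smul' a u := Subtype.ext <| by
    refine Eq.trans (of_sub_apply_eq g ?_) (of_sub_apply_aeval g a _)
    rw [smul_divisionValue, ← aeval_coe, ← smul_of, smul_comm, smul_divisionValue, ← map_smul]
    rfl

theorem kummerLinearMap_apply (g : G F P Ω) {z : kummerField F P Ω} {u : unitModule F}
    (h : P • of F Ω (z : Ω) = incl F Ω u) :
    (kummerLinearMap g u : C F Ω) = of F Ω ((z - g z : kummerField F P Ω) : Ω) :=
  of_sub_apply_eq g ((smul_divisionValue u).trans h.symm)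

/-- The Kummer pairing with `g`: the homomorphism `U(A) / P U(A) → Λ_P` that sends the class of
`φ_P(z)` to `z - g z`. -/
def kummerHom (g : G F P Ω) : KummerHom F P Ω :=
  Submodule.liftQ _ (kummerLinearMap g) <| by
    rintro _ ⟨u, -, rfl⟩
    rw [LinearMap.mem_ker]
    change kummerLinearMap g (P • u) = 0
    rw [map_smul]
    exact Subtype.ext (kummerLinearMap g u).2

theorem kummerHom_mk (g : G F P Ω) {z : kummerField F P Ω} {u : unitModule F}
    (h : P • of F Ω (z : Ω) = incl F Ω u) :
    (kummerHom g (Submodule.Quotient.mk u) : C F Ω) =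
      of F Ω ((z - g z : kummerField F P Ω) : Ω) :=
  kummerLinearMap_apply g h

/-- `U(A) / P U(A)` is generated by the class of `1`. -/
theorem kummerHom_ext {f f' : KummerHom F P Ω}
    (h : f (Submodule.Quotient.mk ⟨of F F[X] 1, Submodule.mem_span_singleton_self _⟩) =
      f' (Submodule.Quotient.mk ⟨of F F[X] 1, Submodule.mem_span_singleton_self _⟩)) : f = f' := by
  refine LinearMap.ext fun x => ?_
  obtain ⟨⟨u, hu⟩, rfl⟩ := Submodule.Quotient.mk_surjective _ x
  obtain ⟨a, rfl⟩ := Submodule.mem_span_singleton.1 hu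
  have := congrArg (a • ·) h
  simp only [← map_smul, ← Submodule.Quotient.mk_smul] at this
  exact this

theorem kummerHom_mul (g h : G F P Ω) : kummerHom (g * h) = kummerHom g + kummerHom h := by
  refine LinearMap.ext fun x => Subtype.ext ?_
  obtain ⟨u, rfl⟩ := Submodule.Quotient.mk_surjective _ x
  obtain ⟨z, hz⟩ := exists_smul_eq_incl (Ω := Ω) (P := P) u
  have hz' : P • of F Ω ((h z : kummerField F P Ω) : Ω) = incl F Ω u :=
    smul_of_apply (h.restrictScalars (RatFunc F)) hz
  rw [LinearMap.add_apply, Submodule.coe_add, kummerHom_mk _ hz, kummerHom_mk h hz,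
    kummerHom_mk g hz']
  have hadd : z - (g * h) z = (h z - g (h z)) + (z - h z) := by
    rw [AlgEquiv.mul_apply, add_comm, sub_add_sub_cancel]
  rw [hadd]
  exact map_add (of F Ω) _ _

theorem kummerHom_injective : Function.Injective (kummerHom (F := F) (P := P) (Ω := Ω)) := by
  intro g h hgh
  refine G_ext fun x hx => ?_
  obtain ⟨u, hu, h'⟩ := hx
  have hx : P • of F Ω (x : Ω) = incl F Ω (⟨u, hu⟩ : unitModule F) := h'.symm
  have h1 := (kummerHom_mk g hx).symm.trans ((by rw [hgh] : _ = _).trans (kummerHom_mk h hx))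
  exact sub_right_injective (Subtype.ext ((of F Ω).injective h1))

/-- The Kummer pairing as an additive map. -/
def kummerAddHom : Additive (G F P Ω) →+ KummerHom F P Ω :=
  AddMonoidHom.mk' (fun g : Additive (G F P Ω) => kummerHom g.toMul) fun g h =>
    kummerHom_mul g.toMul h.toMul

variable (p : ℕ) [Fact p.Prime] [CharP F p]

/-- The Kummer pairing commutes with `Δ`: if `σ` lifts `δ` and `φ_P(z) = u`, then `φ_P(σ z) = u` and
`σ z - (σ g σ⁻¹)(σ z) = σ (z - g z)`. -/
theorem kummerHom_galRep (δ : Delta F P Ω) (g : Additive (G F P Ω)) :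
    kummerHom (galRep F P Ω p δ g).toMul = homRep F P Ω p δ (kummerHom g.toMul) := by
  refine LinearMap.ext fun x => Subtype.ext ?_
  obtain ⟨u, rfl⟩ := Submodule.Quotient.mk_surjective _ x
  obtain ⟨z, hz⟩ := exists_smul_eq_incl (Ω := Ω) (P := P) u
  have hσ := δ.liftNormal_commutes (kummerField F P Ω)
  set σ := δ.liftNormal (kummerField F P Ω)
  rw [kummerHom_mk _ (smul_of_apply σ hz), galRep_apply p δ σ hσ, ← map_sub]
  change _ = of F Ω ((δ (toK F P Ω (kummerHom g.toMul (Submodule.Quotient.mk u))) :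
    cyclotomicField F P Ω) : Ω)
  refine congrArg (of F Ω) ?_
  have h : z - g.toMul z = algebraMap _ _
      (toK F P Ω (kummerHom g.toMul (Submodule.Quotient.mk u))) :=
    Subtype.ext ((of F Ω).injective (kummerHom_mk g.toMul hz).symm)
  rw [h, hσ]
  rfl

/-- `G` moves the solutions of `φ_P(z) = 1`: these are separable over `K_P`, and outside `K_P`. -/
theorem exists_apply_ne (hq : 3 ≤ Fintype.card F) (hP : P.Monic) {z : kummerField F P Ω}
    (hz : aeval (z : Ω) (phik F P) = 1) : ∃ g : G F P Ω, g z ≠ z := by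
  have : Normal (cyclotomicField F P Ω) (kummerField F P Ω) :=
    Normal.tower_top_of_normal (RatFunc F) _ _
  have hsep : Algebra.IsSeparable (cyclotomicField F P Ω) (kummerField F P Ω) := by
    refine (IntermediateField.isSeparable_adjoin_iff_isSeparable _ _).2 fun x hx => ?_
    obtain ⟨u, -, h⟩ := mem_divisionModule.1 hx
    exact (isSeparable_of_aeval_phik hPi.out.ne_zero h).tower_top _
  have : IsGalois (cyclotomicField F P Ω) (kummerField F P Ω) := ⟨⟩
  by_contra! h
  obtain ⟨c, rfl⟩ := (InfiniteGalois.mem_bot_iff_fixed z).2 h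
  refine aeval_phik_ne_one_of_mem hq hPi.out hP c (Subtype.ext ?_)
  rw [← aeval_coe']
  exact hz

/-- Some `g` pairs with the class of `1` to a nonzero `l ∈ Λ_P`, and the conjugates of `g` under `Δ`
then yield all of `Λ_P \ {0}`. -/
theorem kummerHom_surjective (hq : 3 ≤ Fintype.card F) (hP : P.Monic) :
    Function.Surjective (kummerHom (F := F) (P := P) (Ω := Ω)) := by
  obtain ⟨p, hp, n, hpr, -⟩ := FiniteField.card' F
  have : Fact p.Prime := ⟨hpr⟩
  set e : unitModule F := ⟨of F F[X] 1, Submodule.mem_span_singleton_self _⟩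
  obtain ⟨z, hz⟩ := exists_smul_eq_incl (Ω := Ω) (P := P) e
  obtain ⟨g, hg⟩ := exists_apply_ne hq hP (z := z) (by
    rw [smul_of, incl_eq_of_algebraMap] at hz
    simpa [e] using (of F Ω).injective hz)
  intro f
  by_cases hf : f (Submodule.Quotient.mk e) = 0
  · refine ⟨1, kummerHom_ext (Eq.trans (Subtype.ext ?_) hf.symm)⟩
    rw [kummerHom_mk 1 hz]
    exact (congrArg (fun y : kummerField F P Ω => of F Ω (y : Ω)) (sub_self z)).trans
      (map_zero (of F Ω))
  · have h0 : kummerHom g (Submodule.Quotient.mk e) ≠ 0 := fun h => hg <| by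
      have h1 := (kummerHom_mk g hz).symm.trans (congrArg Subtype.val h)
      exact (sub_eq_zero.1 (Subtype.ext ((of F Ω).injective (h1.trans (map_zero _).symm)))).symm
    obtain ⟨δ, hδ⟩ := exists_torsionMap_eq hPi.out hP h0 hf
    refine ⟨(galRep F P Ω p δ (Additive.ofMul g)).toMul, kummerHom_ext ?_⟩
    rw [kummerHom_galRep]
    exact hδ

variable (F P Ω) in
/-- The Kummer pairing as a morphism of representations of `Δ`. -/
def kummerIntertwiningMap :
    Representation.IntertwiningMap (galRep F P Ω p) (homRep F P Ω p) where
  toLinearMap := AddMonoidHom.toZModLinearMap p kummerAddHom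
  isIntertwining' δ := LinearMap.ext fun g => kummerHom_galRep p δ g

end Kummer

end Carlitz

end

theorem lemma6 {F : Type*} [Field F] [Fintype F] (hq : 3 ≤ Fintype.card F)
    (p : ℕ) [Fact p.Prime] [CharP F p]
    (P : F[X]) (hP : P.Monic) [Fact (Irreducible P)]
    (Ω : Type*) [Field Ω] [IsAlgClosed Ω] [Algebra F Ω] [Algebra F[X] Ω] [Algebra (RatFunc F) Ω]
    [IsScalarTower F F[X] Ω] [IsScalarTower F[X] (RatFunc F) Ω] :
    ∃ e : (Carlitz.galRep F P Ω p).asModule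
        ≃ₗ[MonoidAlgebra (ZMod p) (Carlitz.Delta F P Ω)] (Carlitz.homRep F P Ω p).asModule,
      ∀ (g : Carlitz.G F P Ω) (z : Carlitz.kummerField F P Ω) (u : Carlitz.unitModule F),
        P • Carlitz.of F Ω (z : Ω) = Carlitz.incl F Ω u →
        (((Carlitz.homRep F P Ω p).asModuleEquiv
            (e ((Carlitz.galRep F P Ω p).asModuleEquiv.symm (Additive.ofMul g)))
            (Submodule.Quotient.mk u) : Carlitz.torsion F P Ω) : Carlitz.C F Ω) =
          Carlitz.of F Ω ((z - g z : Carlitz.kummerField F P Ω) : Ω) := by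
  have hbij : Function.Bijective (Representation.IntertwiningMap.equivLinearMapAsModule _ _
      (Carlitz.kummerIntertwiningMap F P Ω p)) :=
    ⟨fun g h hgh => Carlitz.kummerHom_injective hgh, Carlitz.kummerHom_surjective hq hP⟩
  exact ⟨LinearEquiv.ofBijective _ hbij, fun g z u h => Carlitz.kummerHom_mk g h⟩
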